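/- For each $n\ge 1$ let $m=m(n)$ be a non-negative integer and let $\overline p=\overline p(n)=(p_1,\dots,p_m)$ with $p_i=p_i(n)\in(0,1)$ for all $1\le i\le m$. The random intersection graph $\mathcal G(n,m,\overline p)$ has vertex set $\mathcal V=\{v_1,\dots,v_n\}$; each vertex $v\in\mathcal V$ has a random feature set $W(v)\subseteq\{w_1,\dots,w_m\}$, where $w_i\in W(v)$ with probability $p_i$, independently for all pairs $(v,w_i)$, and two distinct vertices $v,v'$ are joined by an edge if and only if $W(v)\cap W(v')\ne\emptyset$. Let $\delta(G)$ denote the minimum vertex degree of a graph $G$, and put $$S_1=\sum_{i=1}^{m}np_i\left(1-(1-p_i)^{n-1}\right).$$ Assume that $\max_{1\le i\le m}p_i=o\left((\ln n)^{-1}\right)$ as $n\to\infty$ (the maximum being read as $0$ if $m=0$), and let $(c_n)$ be a sequence of real numbers such that $S_1=n(\ln n+c_n)$ for all sufficiently large $n$. Then $$\lim_{n\to\infty}\Pr\{\delta(\mathcal G(n,m,\overline p))\ge 1\}=\begin{cases}0&\text{if }c_n\to-\infty;\\ e^{-e^{-c}}&\text{if }c_n\to c\in(-\infty,\infty);\\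 1&\text{if }c_n\to\infty.\end{cases}$$ -/

import Mathlib

open Filter Topology Asymptotics MeasureTheory

noncomputable section

namespace RandomIntersectionGraph

/-- An assignment of features in `Fin m` to vertices in `Fin n`:
`ω v i = true` means that vertex `v` has feature `i`. -/
abbrev FeatureAssignment (n m : ℕ) : Type := Fin n → Fin m → Bool

/-- The law of the random feature assignment: every vertex receives feature `i` with
probability `p i`, all these choices being independent. -/
def featureLaw (n : ℕ) {m : ℕ} (p : Fin m → unitInterval) :
    Measure (FeatureAssignment n m) :=
  Measure.pi fun _ : Fin n => Measure.pi fun i : Fin m =>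
    ProbabilityTheory.bernoulliMeasure true false (p i)

/-- The feature set `W(v)`. -/
def featureSet {n m : ℕ} (ω : FeatureAssignment n m) (v : Fin n) : Set (Fin m) :=
  {i | ω v i = true}

/-- The intersection graph: distinct vertices are adjacent when their feature sets intersect.
Under `featureLaw n p` this is the random intersection graph `G(n, m, p)`. -/
def graph {n m : ℕ} (ω : FeatureAssignment n m) : SimpleGraph (Fin n) where
  Adj v w := v ≠ w ∧ (featureSet ω v ∩ featureSet ω w).Nonempty
  symm := ⟨fun _ _ h => ⟨h.1.symm, Set.inter_comm _ _ ▸ h.2⟩⟩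
  loopless := ⟨fun _ h => h.1 rfl⟩

open Classical in
/-- The probability that the minimum degree of `G(n, m, p)` is at least `k`. -/
def probMinDegreeGe (n : ℕ) {m : ℕ} (p : Fin m → unitInterval) (k : ℕ) : ℝ :=
  (featureLaw n p).real {ω | k ≤ (graph ω).minDegree}

/-- `S₁ = ∑ i, n pᵢ (1 - (1 - pᵢ) ^ (n - 1))`. -/
def S₁ (n : ℕ) {m : ℕ} (p : Fin m → unitInterval) : ℝ :=
  ∑ i, (n : ℝ) * (p i : ℝ) * (1 - (1 - (p i : ℝ)) ^ (n - 1))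

end RandomIntersectionGraph

end

/-! Let X count the isolated vertices, so that minimum degree at least 1 means X = 0. Features are
independent, and k given vertices are isolated iff each feature is absent from all of them or held
by exactly one vertex overall, one of the k. Hence E[C(X,k)] is C(n,k) times an exact product over
features (`isolatedMoment_eq`). With a = pᵢ, each factor is exp(-k a (1 - (1-a)^(n-1))) up to O(a²).
The exponents sum to k(ln n + cₙ), and ∑ pᵢ² → 0 when cₙ is bounded above (`tendsto_sum_sq`), so
E[C(X,k)] ~ e^(-k cₙ)/k!. The limits for cₙ → -∞, c, +∞ follow from the second moment, Bonferroni's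
inequalities and the first moment respectively. -/

namespace RandomIntersectionGraph

noncomputable section

/-! ### Binomial moments of the number of isolated vertices -/

open Classical in
/-- The finset of isolated vertices of the intersection graph. -/
def isolatedFinset {n m : ℕ} (ω : FeatureAssignment n m) : Finset (Fin n) :=
  {v | (graph ω).IsIsolated v}

/-- The expected number of `k`-element sets of isolated vertices of `G(n, m, p)`. -/
def isolatedMoment (n : ℕ) {m : ℕ} (p : Fin m → unitInterval) (k : ℕ) : ℝ :=
  ∫ ω, ((isolatedFinset ω).card.choose k : ℝ) ∂(featureLaw n p)

instance (n : ℕ) {m : ℕ} (p : Fin m → unitInterval) : IsProbabilityMeasure (featureLaw n p) := by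
  unfold featureLaw; infer_instance

lemma integrable_featureLaw {n m : ℕ} (p : Fin m → unitInterval)
    (f : FeatureAssignment n m → ℝ) : Integrable f (featureLaw n p) :=
  Integrable.of_finite

/-- Sets of vertices (the carriers of one feature) such that no vertex of `S` shares the feature
with another vertex. -/
def unsharedOn {n : ℕ} (S : Finset (Fin n)) : Set (Fin n → Bool) :=
  {x | ∀ v ∈ S, ∀ w, v ≠ w → ¬ (x v = true ∧ x w = true)}

/-- Isolation splits into one condition per feature, so the probability can factor over features. -/
lemma subset_isolatedFinset_iff {n m : ℕ} (ω : FeatureAssignment n m) (S : Finset (Fin n)) :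
    S ⊆ isolatedFinset ω ↔ ∀ i, (fun v => ω v i) ∈ unsharedOn S := by
  simp only [isolatedFinset, unsharedOn, Finset.subset_iff, Finset.mem_filter, Finset.mem_univ,
    true_and, SimpleGraph.IsIsolated, graph, featureSet, Set.mem_ofPred_eq, Set.Nonempty,
    Set.mem_inter_iff]
  grind

/-- The law is grouped by vertex, while the isolation event factors by feature; transposing
reconciles the two. -/
lemma featureLaw_map_swap (n : ℕ) {m : ℕ} (p : Fin m → unitInterval) :
    (featureLaw n p).map Function.swap =
      Measure.pi fun i : Fin m => Measure.pi fun _ : Fin n =>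
        ProbabilityTheory.bernoulliMeasure true false (p i) := by
  refine Measure.ext_of_singleton fun x => ?_
  rw [Measure.map_apply (measurable_of_finite _) (measurableSet_singleton _)]
  have : (Function.swap ⁻¹' {x} : Set (FeatureAssignment n m)) = {Function.swap x} := by
    ext ω
    simp only [Set.mem_preimage, Set.mem_singleton_iff, funext_iff, Function.swap]
    exact forall_comm
  rw [this, featureLaw]
  simp only [Measure.pi_singleton, Function.swap]
  exact Finset.prod_comm

/-- The two alternatives are disjoint: nobody in `S` carries the feature, or its only carrier among
all n vertices lies in `S`. They yield the two summands of `real_unsharedOn`. -/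
lemma unsharedOn_eq {n : ℕ} (S : Finset (Fin n)) :
    unsharedOn S = (Set.univ.pi fun v => if v ∈ S then {false} else Set.univ) ∪
      ⋃ v ∈ S, {fun w => decide (w = v)} := by
  ext x
  simp only [unsharedOn, Set.mem_ofPred_eq, Set.mem_union, Set.mem_pi, Set.mem_univ, true_imp_iff,
    Set.mem_iUnion, Set.mem_singleton_iff, exists_prop, funext_iff]
  constructor
  · intro h
    by_cases hx : ∃ v ∈ S, x v = true
    · obtain ⟨v, hv, hxv⟩ := hx
      refine Or.inr ⟨v, hv, fun w => ?_⟩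
      by_cases hw : w = v
      · simp [hw, hxv]
      · have := h v hv w (Ne.symm hw)
        simp_all
    · left
      intro v
      split_ifs with hv
      · simpa using fun hxv => hx ⟨v, hv, hxv⟩
      · trivial
  · rintro (h | ⟨u, hu, h⟩) v hv w hvw ⟨hxv, hxw⟩
    · have := h v
      simp_all
    · rw [h] at hxv hxw
      simp at hxv hxw
      exact hvw (hxv.trans hxw.symm)

lemma real_unsharedOn {n : ℕ} (p : unitInterval) (S : Finset (Fin n)) :
    (Measure.pi fun _ : Fin n =>
      ProbabilityTheory.bernoulliMeasure true false p).real (unsharedOn S) =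
      (1 - (p : ℝ)) ^ S.card + S.card * (p * (1 - (p : ℝ)) ^ (n - 1)) := by
  rw [unsharedOn_eq, measureReal_union (h₁ := measure_ne_top _ _) (h₂ := measure_ne_top _ _),
    measureReal_biUnion_finset (h := fun _ _ => measure_ne_top _ _)]
  · congr 1
    · rw [measureReal_def, Measure.pi_pi, ENNReal.toReal_prod]
      have : ∀ v : Fin n, (ProbabilityTheory.bernoulliMeasure true false p
          (if v ∈ S then {false} else Set.univ)).toReal = if v ∈ S then 1 - (p : ℝ) else 1 := by
        intro v
        split_ifs
        · rw [ProbabilityTheory.bernoulliMeasure_apply_of_notMem_of_mem] <;> simp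
        · simp
      simp only [this]
      rw [Finset.prod_ite_mem]
      simp
    · rw [Finset.sum_congr rfl (g := fun _ => (p : ℝ) * (1 - (p : ℝ)) ^ (n - 1))]
      · simp
      · intro v hv
        rw [measureReal_def, Measure.pi_singleton, ENNReal.toReal_prod,
          ← Finset.mul_prod_erase _ _ (Finset.mem_univ v)]
        congr 1
        · rw [ProbabilityTheory.bernoulliMeasure_apply_of_mem_of_notMem] <;> simp
        · rw [Finset.prod_congr rfl (g := fun _ => 1 - (p : ℝ))]
          · simp
          · intro w hw
            rw [ProbabilityTheory.bernoulliMeasure_apply_of_notMem_of_mem] <;> simp_all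
  · intro u _ v _ huv
    simp only [Function.onFun, Set.disjoint_singleton]
    intro h
    have := congrFun h u
    simp [huv] at this
  · intro v _
    exact measurableSet_singleton _
  · simp only [Set.disjoint_iUnion_right, Set.disjoint_singleton_right]
    intro v hv h
    have := h v trivial
    simp [hv] at this
  · exact Set.Finite.measurableSet (Set.toFinite _)

lemma real_subset_isolatedFinset (n : ℕ) {m : ℕ} (p : Fin m → unitInterval) (S : Finset (Fin n)) :
    (featureLaw n p).real {ω | S ⊆ isolatedFinset ω} =
      ∏ i, ((1 - (p i : ℝ)) ^ S.card + S.card * (p i * (1 - (p i : ℝ)) ^ (n - 1))) := by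
  have : {ω : FeatureAssignment n m | S ⊆ isolatedFinset ω} =
      Function.swap ⁻¹' (Set.univ.pi fun _ : Fin m => unsharedOn S) := by
    ext ω
    simp [subset_isolatedFinset_iff]
  rw [this, ← map_measureReal_apply (measurable_of_finite _) (Set.toFinite _).measurableSet,
    featureLaw_map_swap, measureReal_def, Measure.pi_pi, ENNReal.toReal_prod]
  exact Finset.prod_congr rfl fun i _ => real_unsharedOn (p i) S

lemma isolatedMoment_eq (n : ℕ) {m : ℕ} (p : Fin m → unitInterval) (k : ℕ) :
    isolatedMoment n p k =
      n.choose k * ∏ i, ((1 - (p i : ℝ)) ^ k + k * (p i * (1 - (p i : ℝ)) ^ (n - 1))) := by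
  have h : ∀ ω : FeatureAssignment n m, ((isolatedFinset ω).card.choose k : ℝ) =
      ∑ S ∈ Finset.univ.powersetCard k,
        Set.indicator {ω : FeatureAssignment n m | S ⊆ isolatedFinset ω} (fun _ => (1 : ℝ)) ω := by
    intro ω
    classical
    simp only [Set.indicator_apply, Set.mem_ofPred_eq]
    rw [Finset.sum_boole, ← Finset.card_powersetCard]
    congr 2
    ext S
    simp [Finset.mem_powersetCard, and_comm]
  unfold isolatedMoment
  simp only [h]
  rw [integral_finsetSum _ fun _ _ => integrable_featureLaw p _,
    Finset.sum_congr rfl (g := fun _ =>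
      ∏ i, ((1 - (p i : ℝ)) ^ k + k * (p i * (1 - (p i : ℝ)) ^ (n - 1))))]
  · simp
  · intro S hS
    have := integral_indicator_one (μ := featureLaw n p)
      (s := {ω : FeatureAssignment n m | S ⊆ isolatedFinset ω}) (Set.toFinite _).measurableSet
    rw [← (Finset.mem_powersetCard.1 hS).2, ← real_subset_isolatedFinset]
    exact this

/-! ### From moments to the probability of having no isolated vertex -/

lemma probMinDegreeGe_one_eq {n : ℕ} (hn : 0 < n) {m : ℕ} (p : Fin m → unitInterval) :
    probMinDegreeGe n p 1 =
      ∫ ω, (if (isolatedFinset ω).card = 0 then 1 else 0 : ℝ) ∂(featureLaw n p) := by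
  classical
  -- The graph without vertices has minimum degree 0 by convention but no isolated vertex, hence `0
  -- < n`.
  have : Nonempty (Fin n) := ⟨⟨0, hn⟩⟩
  have h := integral_indicator_one (μ := featureLaw n p)
      (s := {ω : FeatureAssignment n m | 1 ≤ (graph ω).minDegree}) (Set.toFinite _).measurableSet
  refine h.symm.trans (integral_congr_ae (ae_of_all _ fun ω => ?_))
  simp only [Set.indicator_apply, Set.mem_ofPred_eq, Pi.one_apply]
  refine if_congr ?_ rfl rfl
  rw [Nat.one_le_iff_ne_zero, ne_eq, SimpleGraph.minDegree_eq_zero_iff]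
  simp [isolatedFinset, Finset.filter_eq_empty_iff]

/-- Bonferroni's inequalities, in the form of a bound for the truncation error. -/
lemma abs_ite_sub_alternating_sum_choose_le (x r : ℕ) :
    |(if x = 0 then 1 else 0 : ℝ) - ∑ k ∈ Finset.range (r + 1), (-1) ^ k * (x.choose k : ℝ)| ≤
      x.choose (r + 1) := by
  cases x with
  | zero => simp [Finset.sum_range_succ']
  | succ x =>
    -- For positive argument the truncated sum is ±C(x,r), at most C(x+1,r+1) by Pascal's rule.
    have h := Int.alternating_sum_range_choose_eq_choose (n := x) (m := r)
    have h' : ∑ k ∈ Finset.range (r + 1), (-1) ^ k * ((x + 1).choose k : ℝ) =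
        (-1) ^ r * x.choose r := by exact_mod_cast h
    rw [h', if_neg (Nat.succ_ne_zero x), zero_sub, abs_neg, abs_mul, abs_pow, abs_neg, abs_one,
      one_pow, one_mul, Nat.abs_cast, Nat.choose_succ_succ]
    push_cast
    linarith [Nat.cast_nonneg (α := ℝ) (x.choose (r + 1))]

lemma abs_probMinDegreeGe_sub_le {n : ℕ} (hn : 0 < n) {m : ℕ} (p : Fin m → unitInterval) (r : ℕ) :
    |probMinDegreeGe n p 1 - ∑ k ∈ Finset.range (r + 1), (-1) ^ k * isolatedMoment n p k| ≤
      isolatedMoment n p (r + 1) := by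
  have h : probMinDegreeGe n p 1 - ∑ k ∈ Finset.range (r + 1), (-1) ^ k * isolatedMoment n p k =
      ∫ ω, ((if (isolatedFinset ω).card = 0 then 1 else 0 : ℝ) -
        ∑ k ∈ Finset.range (r + 1), (-1) ^ k * ((isolatedFinset ω).card.choose k : ℝ))
          ∂(featureLaw n p) := by
    rw [integral_sub (integrable_featureLaw p _) (integrable_featureLaw p _),
      integral_finsetSum _ fun _ _ => integrable_featureLaw p _, probMinDegreeGe_one_eq hn]
    simp only [integral_const_mul, isolatedMoment]
  rw [h]
  refine abs_integral_le_integral_abs.trans (integral_mono (integrable_featureLaw p _)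
    (integrable_featureLaw p _) fun ω => abs_ite_sub_alternating_sum_choose_le _ _)

/-- The second moment bound for the absence of isolated vertices. -/
lemma probMinDegreeGe_mul_sq_le {n : ℕ} (hn : 0 < n) {m : ℕ} (p : Fin m → unitInterval) :
    probMinDegreeGe n p 1 * isolatedMoment n p 1 ^ 2 ≤
      2 * isolatedMoment n p 2 + isolatedMoment n p 1 - isolatedMoment n p 1 ^ 2 := by
  set a := isolatedMoment n p 1 with ha
  -- With X the number of isolated vertices, the integrand is (X - a)², which equals a² on X = 0:
  -- this is Chebyshev's argument.
  have h : 2 * isolatedMoment n p 2 + a - a ^ 2 = ∫ ω, (2 * ((isolatedFinset ω).card.choose 2 : ℝ) +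
      (1 - 2 * a) * ((isolatedFinset ω).card.choose 1 : ℝ) + a ^ 2) ∂(featureLaw n p) := by
    rw [integral_add (integrable_featureLaw p _) (integrable_featureLaw p _),
      integral_add (integrable_featureLaw p _) (integrable_featureLaw p _),
      integral_const_mul, integral_const_mul, integral_const]
    change _ = 2 * isolatedMoment n p 2 + (1 - 2 * a) * a + _
    simp
    ring
  rw [h, probMinDegreeGe_one_eq hn, ← integral_mul_const]
  refine integral_mono (integrable_featureLaw p _) (integrable_featureLaw p _) fun ω => ?_
  simp only [Nat.cast_choose_two, Nat.choose_one_right]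
  split_ifs with h0
  · simp [h0]
  · nlinarith [sq_nonneg ((isolatedFinset ω).card - a)]

end

end RandomIntersectionGraph

namespace RandomIntersectionGraph

/-! ### Estimates for a single feature -/

/-- Combine e^(-x) ≤ 1/(1+x) with (1+x)(1-x+x²) = 1+x³ ≥ 1. -/
lemma exp_neg_le_one_sub_add_sq {x : ℝ} (hx : 0 ≤ x) : Real.exp (-x) ≤ 1 - x + x ^ 2 := by
  rw [Real.exp_neg]
  refine (inv_anti₀ (by positivity) (Real.add_one_le_exp x)).trans ?_
  rw [inv_le_iff_one_le_mul₀ (by positivity)]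
  nlinarith [pow_nonneg hx 3]

/-- Both expressions are 1 - k(a-b) to first order. Used with b = a(1-a)^(n-1). -/
lemma abs_one_sub_pow_add_mul_sub_exp_le {a b : ℝ} (hb : 0 ≤ b) (hba : b ≤ a) (ha : a ≤ 1)
    (k : ℕ) :
    |(1 - a) ^ k + k * b - Real.exp (-(k * (a - b)))| ≤ (k * a) ^ 2 := by
  have hk : (0 : ℝ) ≤ k := k.cast_nonneg
  have h1 : 1 + k * (-a) ≤ (1 + -a) ^ k := one_add_mul_le_pow (by linarith) k
  have h2 : (1 - a) ^ k ≤ Real.exp (-(k * a)) := by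
    rw [← mul_neg, Real.exp_nat_mul]
    exact pow_le_pow_left₀ (by linarith) (Real.one_sub_le_exp_neg a) k
  have h3 := exp_neg_le_one_sub_add_sq (mul_nonneg hk (hb.trans hba))
  have h4 := exp_neg_le_one_sub_add_sq (mul_nonneg hk (sub_nonneg.2 hba))
  have h5 := Real.one_sub_le_exp_neg (k * (a - b))
  have h6 : (k * (a - b)) ^ 2 ≤ (k * a) ^ 2 :=
    pow_le_pow_left₀ (mul_nonneg hk (sub_nonneg.2 hba)) (by gcongr; linarith) 2
  rw [← sub_eq_add_neg] at h1
  rw [abs_le]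
  constructor <;> nlinarith

/-- Let N = n - 1. Since (1-a)(1+a) ≤ 1, Bernoulli gives (1-a)^N ≤ 1/(1+Na), that is, a ≤
(1-(1-a)^N)(1/N + a). Then 1/N ≤ 2/n because n ≥ 2. -/
lemma sq_le_mul_one_sub_one_sub_pow {a : ℝ} (h0 : 0 ≤ a) (h1 : a ≤ 1) {n : ℕ} (hn : 2 ≤ n) :
    a ^ 2 ≤ a * (1 - (1 - a) ^ (n - 1)) * (2 / n + a) := by
  obtain ⟨N, rfl⟩ : ∃ N, n = N + 1 := ⟨n - 1, by omega⟩
  have hN : (1 : ℝ) ≤ N := by exact_mod_cast (by omega : 1 ≤ N)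
  simp only [Nat.add_sub_cancel]
  have h2 : 1 + N * a ≤ (1 + a) ^ N := one_add_mul_le_pow (by linarith) N
  have h3 : (1 - a) ^ N * (1 + N * a) ≤ 1 := by
    calc (1 - a) ^ N * (1 + N * a) ≤ (1 - a) ^ N * (1 + a) ^ N := by
          gcongr
      _ = (1 - a ^ 2) ^ N := by rw [← mul_pow]; ring
      _ ≤ 1 := pow_le_one₀ (by nlinarith) (by nlinarith)
  have h4 : (0 : ℝ) ≤ 1 - (1 - a) ^ N := sub_nonneg.2 (pow_le_one₀ (by linarith) (by linarith))
  have h5 : 1 / (N : ℝ) ≤ 2 / ((N + 1 : ℕ) : ℝ) := by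
    rw [div_le_div_iff₀ (by linarith) (by positivity)]
    push_cast
    linarith
  have h6 : a ≤ (1 - (1 - a) ^ N) * (1 / N + a) := by
    have : (1 - (1 - a) ^ N) * (1 / N + a) = (1 - (1 - a) ^ N) * (1 + N * a) / N := by
      field_simp
    rw [this, le_div_iff₀ (by linarith)]
    linarith
  calc a ^ 2 = a * a := sq a
    _ ≤ a * ((1 - (1 - a) ^ N) * (2 / ((N + 1 : ℕ) : ℝ) + a)) := by
        gcongr
        exact h6.trans (by gcongr)
    _ = _ := by ring

lemma S₁_eq_mul_sum (n : ℕ) {m : ℕ} (p : Fin m → unitInterval) :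
    S₁ n p = n * ∑ i, (p i : ℝ) * (1 - (1 - (p i : ℝ)) ^ (n - 1)) := by
  simp only [S₁, Finset.mul_sum, mul_assoc]

/-! ### Asymptotics of the moments -/

section Asymptotics

variable {m : ℕ → ℕ} {p : (n : ℕ) → Fin (m n) → unitInterval} {c : ℕ → ℝ}

lemma eventually_sum_eq
    (hS : ∀ᶠ n : ℕ in atTop, S₁ n (p n) = (n : ℝ) * (Real.log n + c n)) :
    ∀ᶠ n : ℕ in atTop, ∑ i, (p n i : ℝ) * (1 - (1 - (p n i : ℝ)) ^ (n - 1)) =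
      Real.log n + c n := by
  filter_upwards [hS, eventually_gt_atTop 0] with n h hn
  rw [S₁_eq_mul_sum] at h
  exact mul_left_cancel₀ (by exact_mod_cast hn.ne') h

/-- Summing `sq_le_mul_one_sub_one_sub_pow` bounds the sum by (ln n + C)(2/n + max pᵢ), and max pᵢ =
o(1/ln n). This controls the total second-order error. -/
lemma tendsto_sum_sq
    (hmax : (fun n : ℕ => ⨆ i, (p n i : ℝ)) =o[atTop] (fun n : ℕ => (Real.log n)⁻¹))
    (hS : ∀ᶠ n : ℕ in atTop, S₁ n (p n) = (n : ℝ) * (Real.log n + c n))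
    {C : ℝ} (hc : ∀ᶠ n in atTop, c n ≤ C) :
    Tendsto (fun n => ∑ i, (p n i : ℝ) ^ 2) atTop (𝓝 0) := by
  have hlog : Tendsto (fun n : ℕ => Real.log n) atTop atTop :=
    Real.tendsto_log_atTop.comp tendsto_natCast_atTop_atTop
  have h1 : Tendsto (fun n : ℕ => (⨆ i, (p n i : ℝ)) * Real.log n) atTop (𝓝 0) := by
    simpa only [div_inv_eq_mul] using hmax.tendsto_div_nhds_zero
  have h2 : Tendsto (fun n : ℕ => ⨆ i, (p n i : ℝ)) atTop (𝓝 0) :=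
    hmax.trans_tendsto hlog.inv_tendsto_atTop
  have h3 : Tendsto (fun n : ℕ => 2 / (n : ℝ)) atTop (𝓝 0) :=
    tendsto_const_div_atTop_nhds_zero_nat 2
  have h4 : Tendsto (fun n : ℕ => 2 / (n : ℝ) * Real.log n) atTop (𝓝 0) := by
    have := (Real.isLittleO_log_id_atTop.comp_tendsto
      (tendsto_natCast_atTop_atTop (R := ℝ))).tendsto_div_nhds_zero.const_mul 2
    simp only [Function.comp_apply, id_eq, mul_zero] at this
    exact this.congr fun n => by ring
  have h5 : Tendsto (fun n : ℕ => (Real.log n + C) * (2 / (n : ℝ) + ⨆ i, (p n i : ℝ)))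
      atTop (𝓝 0) := by
    have := (h4.add h1).add ((h3.add h2).const_mul C)
    simp only [add_zero, mul_zero] at this
    exact this.congr fun n => by ring
  refine squeeze_zero' (Eventually.of_forall fun n => by positivity) ?_ h5
  filter_upwards [eventually_sum_eq hS, hc, eventually_ge_atTop 2] with n hn hcn hn2
  have hsup : ∀ i, (p n i : ℝ) ≤ ⨆ i, (p n i : ℝ) :=
    le_ciSup (Set.toFinite _).bddAbove
  have hw : ∀ i, 0 ≤ (p n i : ℝ) * (1 - (1 - (p n i : ℝ)) ^ (n - 1)) := fun i =>
    mul_nonneg (p n i).2.1 (sub_nonneg.2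
      (pow_le_one₀ (sub_nonneg.2 (p n i).2.2) (by linarith [(p n i).2.1])))
  calc ∑ i, (p n i : ℝ) ^ 2
      ≤ ∑ i, (p n i : ℝ) * (1 - (1 - (p n i : ℝ)) ^ (n - 1)) *
          (2 / (n : ℝ) + ⨆ i, (p n i : ℝ)) := by
        refine Finset.sum_le_sum fun i _ =>
          (sq_le_mul_one_sub_one_sub_pow (p n i).2.1 (p n i).2.2 hn2).trans ?_
        exact mul_le_mul_of_nonneg_left (by linarith [hsup i]) (hw i)
    _ = (Real.log n + c n) * (2 / (n : ℝ) + ⨆ i, (p n i : ℝ)) := by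
        rw [← Finset.sum_mul, hn]
    _ ≤ _ := by
        have : 0 ≤ ⨆ i, (p n i : ℝ) := Real.iSup_nonneg fun i => (p n i).2.1
        gcongr

/-- The probability that `k` given vertices are isolated is asymptotically the `k`-th power of
`exp (-S₁ / n)`. -/
lemma tendsto_prod_mul_exp (hp : Tendsto (fun n => ∑ i, (p n i : ℝ) ^ 2) atTop (𝓝 0)) (k : ℕ) :
    Tendsto (fun n => (∏ i, ((1 - (p n i : ℝ)) ^ k + k * (p n i * (1 - (p n i : ℝ)) ^ (n - 1)))) *
      Real.exp (k * ∑ i, (p n i : ℝ) * (1 - (1 - (p n i : ℝ)) ^ (n - 1)))) atTop (𝓝 1) := by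
  set t : (n : ℕ) → Fin (m n) → ℝ := fun n i =>
    ((1 - (p n i : ℝ)) ^ k + k * (p n i * (1 - (p n i : ℝ)) ^ (n - 1))) *
      Real.exp (k * ((p n i : ℝ) * (1 - (1 - (p n i : ℝ)) ^ (n - 1)))) with ht
  have hprod : ∀ n, (∏ i, ((1 - (p n i : ℝ)) ^ k + k * (p n i * (1 - (p n i : ℝ)) ^ (n - 1)))) *
      Real.exp (k * ∑ i, (p n i : ℝ) * (1 - (1 - (p n i : ℝ)) ^ (n - 1))) =
      ∏ i, (1 + (t n i - 1)) := by
    intro n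
    rw [Finset.mul_sum, Real.exp_sum, ← Finset.prod_mul_distrib]
    simp [ht]
  -- The factor e^k comes from multiplying the error (ka)² by an exponential whose exponent is at
  -- most k.
  have hbound : ∀ n i, ‖t n i - 1‖ ≤ (k ^ 2 * Real.exp k) * (p n i : ℝ) ^ 2 := by
    intro n i
    set a : ℝ := (p n i : ℝ)
    have ha0 : 0 ≤ a := (p n i).2.1
    have ha1 : a ≤ 1 := (p n i).2.2
    have hpow0 : 0 ≤ (1 - a) ^ (n - 1) := pow_nonneg (by linarith) _
    have hpow1 : (1 - a) ^ (n - 1) ≤ 1 := pow_le_one₀ (by linarith) (by linarith)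
    have hb0 : 0 ≤ a * (1 - a) ^ (n - 1) := mul_nonneg ha0 hpow0
    have h := abs_one_sub_pow_add_mul_sub_exp_le hb0 (mul_le_of_le_one_right ha0 hpow1) ha1 k
    have hq : a * (1 - (1 - a) ^ (n - 1)) = a - a * (1 - a) ^ (n - 1) := by ring
    have heq : t n i - 1 = ((1 - a) ^ k + k * (a * (1 - a) ^ (n - 1)) -
        Real.exp (-(k * (a - a * (1 - a) ^ (n - 1))))) *
        Real.exp (k * (a - a * (1 - a) ^ (n - 1))) := by
      rw [sub_mul, ← Real.exp_add, neg_add_cancel, Real.exp_zero, ← hq]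
    rw [heq, norm_mul, Real.norm_eq_abs, Real.norm_eq_abs, Real.abs_exp]
    calc _ ≤ (k * a) ^ 2 * Real.exp k := by
          gcongr
          exact mul_le_of_le_one_right k.cast_nonneg (by linarith)
      _ = _ := by ring
  have hlim : Tendsto (fun n => Real.exp ((k ^ 2 * Real.exp k) * ∑ i, (p n i : ℝ) ^ 2) - 1)
      atTop (𝓝 0) := by
    simpa using ((Real.continuous_exp.tendsto _).comp
      (hp.const_mul (k ^ 2 * Real.exp k))).sub_const 1
  simp only [hprod]
  rw [tendsto_iff_norm_sub_tendsto_zero]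
  refine squeeze_zero (fun _ => norm_nonneg _) (fun n => ?_) hlim
  -- |∏(1+xᵢ) - 1| ≤ exp(∑|xᵢ|) - 1 turns the termwise bounds into one for the product.
  refine (Finset.norm_prod_one_add_sub_one_le _ _).trans ?_
  rw [Finset.mul_sum]
  gcongr with i
  exact hbound n i

lemma tendsto_choose_div_pow (k : ℕ) :
    Tendsto (fun n : ℕ => (n.choose k : ℝ) / (n : ℝ) ^ k) atTop (𝓝 ((k.factorial : ℝ)⁻¹)) := by
  have h := (isEquivalent_choose k).div (IsEquivalent.refl (u := fun n : ℕ => (n : ℝ) ^ k))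
  refine h.symm.tendsto_nhds (tendsto_const_nhds.congr' ?_)
  filter_upwards [eventually_gt_atTop 0] with n hn
  have : (n : ℝ) ≠ 0 := by exact_mod_cast hn.ne'
  simp only [Pi.div_apply]
  field_simp

lemma tendsto_isolatedMoment_mul_exp
    (hmax : (fun n : ℕ => ⨆ i, (p n i : ℝ)) =o[atTop] (fun n : ℕ => (Real.log n)⁻¹))
    (hS : ∀ᶠ n : ℕ in atTop, S₁ n (p n) = (n : ℝ) * (Real.log n + c n))
    {C : ℝ} (hc : ∀ᶠ n in atTop, c n ≤ C) (k : ℕ) :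
    Tendsto (fun n => isolatedMoment n (p n) k * Real.exp (k * c n)) atTop
      (𝓝 ((k.factorial : ℝ)⁻¹)) := by
  have h := (tendsto_choose_div_pow k).mul
    (tendsto_prod_mul_exp (tendsto_sum_sq hmax hS hc) k)
  rw [mul_one] at h
  refine h.congr' ?_
  filter_upwards [eventually_sum_eq hS, eventually_gt_atTop 0] with n hn hn0
  have hn0' : (0 : ℝ) < n := by exact_mod_cast hn0
  rw [hn, isolatedMoment_eq, mul_add, Real.exp_add, Real.exp_nat_mul, Real.exp_log hn0']
  generalize (∏ i, ((1 - (p n i : ℝ)) ^ k + k * (p n i * (1 - (p n i : ℝ)) ^ (n - 1)))) = P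
  field_simp

/-! ### The three regimes -/

lemma tendsto_zero_of_tendsto_atBot
    (hmax : (fun n : ℕ => ⨆ i, (p n i : ℝ)) =o[atTop] (fun n : ℕ => (Real.log n)⁻¹))
    (hS : ∀ᶠ n : ℕ in atTop, S₁ n (p n) = (n : ℝ) * (Real.log n + c n))
    (hc : Tendsto c atTop atBot) :
    Tendsto (fun n => probMinDegreeGe n (p n) 1) atTop (𝓝 0) := by
  have h1 := tendsto_isolatedMoment_mul_exp hmax hS (hc.eventually_le_atBot 0) 1
  have h2 := tendsto_isolatedMoment_mul_exp hmax hS (hc.eventually_le_atBot 0) 2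
  have h0 : Tendsto (fun n => Real.exp (c n)) atTop (𝓝 0) := Real.tendsto_exp_atBot.comp hc
  simp only [Nat.cast_one, one_mul, Nat.factorial_one, inv_one] at h1
  -- This is the second moment bound with numerator and denominator scaled by e^(2cₙ); the numerator
  -- tends to 2·(1/2) + 0 - 1 = 0 and the denominator to 1.
  have hlim : Tendsto (fun n => (2 * (isolatedMoment n (p n) 2 * Real.exp ((2 : ℕ) * c n)) +
      isolatedMoment n (p n) 1 * Real.exp (c n) * Real.exp (c n) -
      (isolatedMoment n (p n) 1 * Real.exp (c n)) ^ 2) /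
      (isolatedMoment n (p n) 1 * Real.exp (c n)) ^ 2) atTop (𝓝 0) := by
    have := (((h2.const_mul 2).add (h1.mul h0)).sub (h1.pow 2)).div (h1.pow 2) (by norm_num)
    norm_num at this
    exact_mod_cast this
  refine squeeze_zero' (Eventually.of_forall fun n => measureReal_nonneg) ?_ hlim
  filter_upwards [h1.eventually (lt_mem_nhds one_pos), eventually_gt_atTop 0] with n hpos hn
  rw [le_div_iff₀ (by positivity)]
  have := mul_le_mul_of_nonneg_right (probMinDegreeGe_mul_sq_le hn (p n))
    (sq_nonneg (Real.exp (c n)))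
  rw [Real.exp_nat_mul]
  linarith

lemma tendsto_of_tendsto_nhds
    (hmax : (fun n : ℕ => ⨆ i, (p n i : ℝ)) =o[atTop] (fun n : ℕ => (Real.log n)⁻¹))
    (hS : ∀ᶠ n : ℕ in atTop, S₁ n (p n) = (n : ℝ) * (Real.log n + c n))
    {c₀ : ℝ} (hc : Tendsto c atTop (𝓝 c₀)) :
    Tendsto (fun n => probMinDegreeGe n (p n) 1) atTop (𝓝 (Real.exp (-Real.exp (-c₀)))) := by
  set l := Real.exp (-c₀)
  have hmom : ∀ k, Tendsto (fun n => isolatedMoment n (p n) k) atTop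
      (𝓝 (l ^ k / k.factorial)) := by
    intro k
    have h := (tendsto_isolatedMoment_mul_exp hmax hS
      (hc.eventually_le_const (lt_add_one c₀)) k).mul
      ((Real.continuous_exp.tendsto _).comp (hc.const_mul (k : ℝ)).neg)
    have hlim : (k.factorial : ℝ)⁻¹ * Real.exp (-(k * c₀)) = l ^ k / k.factorial := by
      rw [← mul_neg, Real.exp_nat_mul, div_eq_inv_mul]
    rw [hlim] at h
    refine h.congr fun n => ?_
    rw [Function.comp_apply, mul_assoc, ← Real.exp_add, add_neg_cancel, Real.exp_zero, mul_one]
  have hexp : Tendsto (fun r => ∑ k ∈ Finset.range (r + 1), (-1) ^ k * (l ^ k / k.factorial)) atTop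
      (𝓝 (Real.exp (-l))) := by
    have h := (NormedSpace.expSeries_div_hasSum_exp (-l)).tendsto_sum_nat
    rw [← Real.exp_eq_exp_ℝ] at h
    refine (h.comp (tendsto_add_atTop_nat 1)).congr fun r => Finset.sum_congr rfl fun k _ => ?_
    rw [neg_pow l, mul_div_assoc]
  have hterm : Tendsto (fun r => l ^ (r + 1) / (r + 1).factorial) atTop (𝓝 0) :=
    (FloorSemiring.tendsto_pow_div_factorial_atTop l).comp (tendsto_add_atTop_nat 1)
  rw [Metric.tendsto_atTop']
  intro ε hε
  -- The truncation level r is fixed before n grows, so only finitely many moments need to converge.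
  obtain ⟨r, hr1, hr2⟩ := ((hexp.eventually (Metric.ball_mem_nhds _ (by positivity : 0 < ε / 3))).and
    (hterm.eventually_lt_const (by positivity : 0 < ε / 3))).exists
  have hsum : Tendsto (fun n => ∑ k ∈ Finset.range (r + 1), (-1) ^ k * isolatedMoment n (p n) k)
      atTop (𝓝 (∑ k ∈ Finset.range (r + 1), (-1) ^ k * (l ^ k / k.factorial))) :=
    tendsto_finsetSum _ fun k _ => (hmom k).const_mul _
  have hev : ∀ᶠ n in atTop, dist (probMinDegreeGe n (p n) 1) (Real.exp (-l)) < ε := by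
    filter_upwards [hsum.eventually (Metric.ball_mem_nhds _ (by positivity : 0 < ε / 3)),
      (hmom (r + 1)).eventually_lt_const hr2, eventually_gt_atTop 0] with n hn1 hn2 hn
    have h3 := abs_probMinDegreeGe_sub_le hn (p n) r
    rw [← Real.dist_eq] at h3
    refine (dist_triangle4 _ _ _ _).trans_lt (add_lt_add (add_lt_add (h3.trans_lt hn2) hn1) hr1
      |>.trans_eq (by ring))
  obtain ⟨N, hN⟩ := eventually_atTop.1 hev
  exact ⟨N, fun n hn => hN n hn.le⟩

lemma tendsto_one_of_tendsto_atTop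
    (hS : ∀ᶠ n : ℕ in atTop, S₁ n (p n) = (n : ℝ) * (Real.log n + c n))
    (hc : Tendsto c atTop atTop) :
    Tendsto (fun n => probMinDegreeGe n (p n) 1) atTop (𝓝 1) := by
  have hlim : Tendsto (fun n => 1 - Real.exp (-c n)) atTop (𝓝 1) := by
    simpa using (Real.tendsto_exp_neg_atTop_nhds_zero.comp hc).const_sub 1
  refine tendsto_of_tendsto_of_tendsto_of_le_of_le' hlim tendsto_const_nhds ?_
    (Eventually.of_forall fun n => measureReal_le_one)
  filter_upwards [eventually_sum_eq hS, eventually_gt_atTop 0] with n hn hn0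
  have hn0' : (0 : ℝ) < n := by exact_mod_cast hn0
  -- Bonferroni truncated at r = 0 is Markov's bound P(X ≥ 1) ≤ E[X].
  have h := abs_probMinDegreeGe_sub_le hn0 (p n) 0
  have h0 : isolatedMoment n (p n) 0 = 1 := by simp [isolatedMoment_eq]
  simp only [zero_add, Finset.range_one, Finset.sum_singleton, pow_zero, one_mul, h0] at h
  have h1 : isolatedMoment n (p n) 1 ≤ Real.exp (-c n) := by
    rw [isolatedMoment_eq]
    calc _ ≤ (n.choose 1 : ℝ) * ∏ i,
          Real.exp (-((p n i : ℝ) * (1 - (1 - (p n i : ℝ)) ^ (n - 1)))) := by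
          gcongr with i
          · intro i _
            have h1 : 0 ≤ 1 - (p n i : ℝ) := sub_nonneg.2 (p n i).2.2
            have h2 : 0 ≤ (p n i : ℝ) := (p n i).2.1
            positivity
          -- For k = 1 the factor is exactly 1 - x with x = a(1-(1-a)^(n-1)), so 1 - x ≤ e^(-x)
          -- leaves no error term to control.
          · refine le_trans (le_of_eq ?_) (Real.one_sub_le_exp_neg _)
            push_cast
            ring
      _ = Real.exp (-c n) := by
          rw [← Real.exp_sum, Finset.sum_neg_distrib, hn, neg_add, Real.exp_add, Real.exp_neg,
            Real.exp_log hn0', Nat.choose_one_right]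
          field_simp
  linarith [(abs_le.1 h).1]

end Asymptotics

end RandomIntersectionGraph

theorem mainTheorem2 (m : ℕ → ℕ) (p : (n : ℕ) → Fin (m n) → unitInterval) (c : ℕ → ℝ)
    (hp : ∀ n i, 0 < (p n i : ℝ) ∧ (p n i : ℝ) < 1)
    (hmax : (fun n : ℕ => ⨆ i, (p n i : ℝ)) =o[atTop] (fun n : ℕ => (Real.log n)⁻¹))
    (hS : ∀ᶠ n : ℕ in atTop,
      RandomIntersectionGraph.S₁ n (p n) = (n : ℝ) * (Real.log n + c n)) :
    (Tendsto c atTop atBot →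
      Tendsto (fun n => RandomIntersectionGraph.probMinDegreeGe n (p n) 1) atTop (𝓝 0)) ∧
    (∀ c₀ : ℝ, Tendsto c atTop (𝓝 c₀) →
      Tendsto (fun n => RandomIntersectionGraph.probMinDegreeGe n (p n) 1) atTop
        (𝓝 (Real.exp (-Real.exp (-c₀))))) ∧
    (Tendsto c atTop atTop →
      Tendsto (fun n => RandomIntersectionGraph.probMinDegreeGe n (p n) 1) atTop (𝓝 1)) := by
  exact ⟨RandomIntersectionGraph.tendsto_zero_of_tendsto_atBot hmax hS,
    fun _ => RandomIntersectionGraph.tendsto_of_tendsto_nhds hmax hS,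
    RandomIntersectionGraph.tendsto_one_of_tendsto_atTop hS⟩
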